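/- All matroids are finite. For subsets $X,Y$ of the ground set $E(M)$ of a matroid $M$ with rank function $r$, write $\sqcap(X,Y)=r(X)+r(Y)-r(X\cup Y)$. An exact $3$-separation of $M$ is a partition $(A,B)$ of $E(M)$ with $|A|,|B|\ge 3$ and $r(A)+r(B)-r(M)=2$; given one, an $A$-strand is a minimal subset $A'$ of $A$ with $\sqcap(A',B)=1$, and a $B$-strand is a minimal subset $B'$ of $B$ with $\sqcap(B',A)=1$. An extension of $M$ by a set $P$ disjoint from $E(M)$ is a matroid $N$ with ground set $E(M)\cup P$ and $N\backslash P=M$. Theorem. Let $T$ be an $n$-vertex tree, $n\ge 1$, whose vertices are labelled by non-empty pairwise disjoint sets $X_1,\dots,X_n$, and let $M$ be a matroid with ground set $E=X_1\cup\dots\cup X_n$. For each edge $e$ of $T$, let $(Y_e,Z_e)$ be the induced partition of $E$; that is, $Y_e$ and $Z_e$ are the unions of the labels of the vertices in the two components of $T\backslash e$. Suppose that, for every edge $e$ of $T$, the pair $(Y_e,Z_e)$ is an exact $3$-separation of $M$ and there are an integer $m_e\ge 0$, $Y_e$-strands $Y_{e1},\dots,Y_{em_e}$ and $Z_e$-strands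 $Z_{e1},\dots,Z_{em_e}$ such that, for each $k\in\{1,\dots,m_e\}$, $\sqcap(Y_{ek},Z_{ek})=1$ and there is an extension of $M$ by an element $p_{ek}\notin E$ in which $Y_{ek}\cup\{p_{ek}\}$ and $Z_{ek}\cup\{p_{ek}\}$ are circuits. Suppose that the elements $p_{ek}$, over all $e\in E(T)$ and $1\le k\le m_e$, are distinct. Then there is exactly one extension $M'$ of $M$ by $\bigcup_{e\in E(T)}\{p_{e1},\dots,p_{em_e}\}$ such that $Y_{ek}\cup\{p_{ek}\}$ and $Z_{ek}\cup\{p_{ek}\}$ are circuits of $M'$ for all $e\in E(T)$ and all $k\in\{1,\dots,m_e\}$. -/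

import Mathlib

namespace Matroid

/-- The rank `r(X)` of a set `X` in a matroid, as a natural number. (Every matroid to which this
is applied below is finite, so the extended rank is finite and nothing is lost.) -/
noncomputable def rkNat {α : Type*} (M : Matroid α) (X : Set α) : ℕ := (M.eRk X).toNat

/-- The local connectivity `⊓(X, Y) = r(X) + r(Y) - r(X ∪ Y)`. -/
noncomputable def localConn {α : Type*} (M : Matroid α) (X Y : Set α) : ℤ :=
  (M.rkNat X : ℤ) + (M.rkNat Y : ℤ) - (M.rkNat (X ∪ Y) : ℤ)

/-- `(A, B)` is an exact `3`-separation of `M`: a partition of the ground set with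
`|A|, |B| ≥ 3` and `r(A) + r(B) - r(M) = 2`. -/
structure IsExactThreeSeparation {α : Type*} (M : Matroid α) (A B : Set α) : Prop where
  disjoint : Disjoint A B
  union_eq : A ∪ B = M.E
  three_le_left : 3 ≤ A.encard
  three_le_right : 3 ≤ B.encard
  conn_eq : (M.rkNat A : ℤ) + (M.rkNat B : ℤ) - (M.rkNat M.E : ℤ) = 2

/-- `S` is an `A`-strand with respect to `(A, B)`: a minimal subset of `A` with `⊓(S, B) = 1`.
The `B`-strands are obtained by exchanging `A` and `B`. -/
def IsStrand {α : Type*} (M : Matroid α) (A B S : Set α) : Prop :=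
  Minimal (fun S' : Set α => S' ⊆ A ∧ M.localConn S' B = 1) S

/-- `N` is an extension of `M` by the set `P` of new elements: `P` is disjoint from `E(M)`,
`E(N) = E(M) ∪ P` and `N ＼ P = M`. -/
structure IsExtensionBy {α : Type*} (N M : Matroid α) (P : Set α) : Prop where
  disjoint : Disjoint M.E P
  ground_eq : N.E = M.E ∪ P
  delete_eq : N.delete P = M

end Matroid

namespace SimpleGraph

/-- The union of the labels `X w` over the vertices `w` that lie in the same component as `u`
after the edge `e` has been deleted from `T`. -/
def labelSide {V α : Type*} (T : SimpleGraph V) (X : V → Set α) (e : Sym2 V) (u : V) : Set α :=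
  ⋃ w ∈ {w : V | (T.deleteEdges {e}).Reachable u w}, X w

/-- `(Y, Z)` is the partition induced by the edge `e` of the labelled tree `T`: `Y` and `Z` are
the unions of the labels of the two components of `T` with `e` deleted, in either order. -/
def InducesPartition {V α : Type*} (T : SimpleGraph V) (X : V → Set α) (e : Sym2 V)
    (Y Z : Set α) : Prop :=
  ∃ u v : V, e = s(u, v) ∧ Y = T.labelSide X e u ∧ Z = T.labelSide X e v

end SimpleGraph

/-! For an exact 3-separation, think of the guts as a line on which the spans of the two sides would
meet. A set in `A` with connectivity one to `B` determines a point of that line, a set with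
connectivity two the whole line. Strands `S` and `T` with `⊓(S, T) = 1` determine a common point,
and the new element `p` is placed there.

Which sets span `p` can be read off from `M`. For `G ⊆ A` and `F ⊆ B`, the set `G ∪ F` spans `p`
exactly when `G` does, when `F` does, or when `G` and `F` have distinct points and so generate the
line together (`SpansPoint`). Hence one point has at most one extension (`isPointExtension_unique`).
Conversely, this recipe defines an extension provided that "having the same point" behaves
consistently (`IsCoherent`). Any existing extension forces this condition, which speaks of `M`
alone.

Several points are added one at a time. The separations of a tree do not cross. A new point on the
guts of `(C, D)` joins the side of `(A, B)` containing `C` or `D`, and seen from `D` a subset of `C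
∪ {p}` acts like a subset of `C` (`exists_replacement`). So coherence, and with it the possibility
of adding the remaining points, survives each step. Uniqueness follows by deleting back to one
point. -/

open Set

namespace Matroid

/-! ### Rank and local connectivity -/

section Rank

variable {α : Type*} (M : Matroid α) [M.Finite] {X Y A B F G : Set α} {a : α}

lemma coe_rkNat (X : Set α) : (M.rkNat X : ℕ∞) = M.eRk X :=
  ENat.natCast_toNat (eRk_ne_top_iff.2 (M.isRkFinite_set X))

lemma rkNat_mono (h : X ⊆ Y) : M.rkNat X ≤ M.rkNat Y := by
  have := M.eRk_mono h
  rw [← coe_rkNat, ← coe_rkNat] at this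
  exact_mod_cast this

lemma rkNat_submod (X Y : Set α) :
    M.rkNat (X ∩ Y) + M.rkNat (X ∪ Y) ≤ M.rkNat X + M.rkNat Y := by
  have := M.eRk_inter_add_eRk_union_le X Y
  simp only [← coe_rkNat] at this
  exact_mod_cast this

/-- Submodularity as decreasing marginal rank, the form in which most later inequalities are fed to
`omega`. -/
lemma rkNat_union_add_le (h : X ⊆ Y) (F : Set α) :
    M.rkNat (Y ∪ F) + M.rkNat X ≤ M.rkNat Y + M.rkNat (X ∪ F) := by
  have h1 := M.rkNat_submod Y (X ∪ F)
  have h2 : M.rkNat X ≤ M.rkNat (Y ∩ (X ∪ F)) :=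
    M.rkNat_mono (subset_inter h subset_union_left)
  rw [show Y ∪ (X ∪ F) = Y ∪ F by rw [← union_assoc, union_eq_self_of_subset_right h]] at h1
  omega

lemma rkNat_insert_add_le (h : X ⊆ Y) (a : α) :
    M.rkNat (insert a Y) + M.rkNat X ≤ M.rkNat Y + M.rkNat (insert a X) := by
  simpa only [union_singleton] using M.rkNat_union_add_le h {a}

lemma rkNat_insert_le (a : α) (X : Set α) : M.rkNat (insert a X) ≤ M.rkNat X + 1 := by
  have := M.eRk_insert_le_add_one a X
  simp only [← coe_rkNat] at this
  exact_mod_cast this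

lemma rkNat_le_insert (a : α) (X : Set α) : M.rkNat X ≤ M.rkNat (insert a X) :=
  M.rkNat_mono (subset_insert a X)

omit [M.Finite] in
@[simp] lemma rkNat_empty : M.rkNat ∅ = 0 := by simp [rkNat]

lemma indep_iff_rkNat (hX : X ⊆ M.E) : M.Indep X ↔ M.rkNat X = X.ncard := by
  have hfin : X.Finite := M.ground_finite.subset hX
  rw [indep_iff_eRk_eq_encard_of_finite hfin, ← coe_rkNat, ← hfin.cast_ncard_eq]
  norm_cast

lemma mem_closure_iff_rkNat (ha : a ∈ M.E) :
    a ∈ M.closure X ↔ M.rkNat (insert a X) = M.rkNat X := by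
  refine ⟨fun h ↦ ?_, fun h ↦ by_contra fun hcl ↦ ?_⟩
  · rw [rkNat, ← eRk_insert_closure_eq, insert_eq_of_mem h, eRk_closure_eq, rkNat]
  · have := M.eRk_insert_eq_add_one ⟨ha, hcl⟩
    simp only [← coe_rkNat] at this
    norm_cast at this
    omega

omit [M.Finite] in
lemma localConn_comm (X Y : Set α) : M.localConn X Y = M.localConn Y X := by
  simp only [localConn, union_comm X Y]
  ring

lemma localConn_mono_left (h : G ⊆ A) (F : Set α) : M.localConn G F ≤ M.localConn A F := by
  have := M.rkNat_union_add_le h F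
  simp only [localConn]
  omega

lemma localConn_mono (h : G ⊆ A) (h' : F ⊆ B) : M.localConn G F ≤ M.localConn A B := by
  have h1 := M.localConn_mono_left h F
  have h2 := M.localConn_mono_left h' A
  rw [localConn_comm, M.localConn_comm B] at h2
  omega

lemma localConn_nonneg (X Y : Set α) : 0 ≤ M.localConn X Y := by
  have := M.rkNat_submod X Y
  simp only [localConn]
  omega

omit [M.Finite] in
@[simp] lemma localConn_empty_left (X : Set α) : M.localConn ∅ X = 0 := by simp [localConn]

/-- If `G ⊆ A` has full connectivity to `B`, then `G` and `A` are connected alike to every subset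
of `B`. -/
lemma localConn_eq_of_full (hG : G ⊆ A) (hF : F ⊆ B) (h : M.localConn G B = M.localConn A B) :
    M.localConn G F = M.localConn A F := by
  -- Fullness says that `A` adds `r(A) - r(G)` to the rank of `G ∪ B`. It adds at least as much to
  -- the smaller set `G ∪ F`.
  have h1 := M.rkNat_union_add_le (union_subset_union_right G hF) A
  have h2 := M.localConn_mono_left hG F
  rw [show G ∪ B ∪ A = A ∪ B by rw [union_right_comm, union_eq_self_of_subset_left hG],
    show G ∪ F ∪ A = A ∪ F by rw [union_right_comm, union_eq_self_of_subset_left hG]] at h1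
  simp only [localConn] at *
  omega

omit [M.Finite] in
lemma localConn_insert_left (a : α) (G F : Set α) : M.localConn (insert a G) F =
    M.rkNat (insert a G) + M.rkNat F - M.rkNat (insert a (G ∪ F)) := by
  rw [localConn, insert_union]

end Rank

/-! ### Matroids and single-element extensions from rank data -/

section OfRank

variable {α : Type*} {E : Set α} {r : Set α → ℤ}

/-- Elements of `Y` are absorbed into `X` one at a time; `h_loc` keeps the hypothesis true for those
still to come. -/
lemma rank_union_eq_of_forall_insert (hE : E.Finite)
    (h_loc : ∀ X ⊆ E, ∀ a ∈ E, ∀ b ∈ E, r (insert a X) = r X → r (insert b X) = r X →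
      r (insert a (insert b X)) = r X) {X Y : Set α} (hX : X ⊆ E) (hY : Y ⊆ E)
    (h : ∀ a ∈ Y, r (insert a X) = r X) : r (X ∪ Y) = r X := by
  have hYfin := hE.subset hY
  induction Y, hYfin using Set.Finite.induction_on generalizing X with
  | empty => simp
  | @insert a Y _ _ ih =>
    rw [insert_subset_iff] at hY
    have ha := h a (mem_insert a Y)
    rw [union_insert, ← insert_union, ih (insert_subset hY.1 hX) hY.2, ha]
    intro b hb
    rw [ha]
    exact h_loc X hX b (hY.2 hb) a hY.1 (h b (mem_insert_of_mem a hb)) ha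

/-- A matroid on a finite ground set from a rank function given by its local axioms. -/
theorem exists_of_rank (hE : E.Finite) (h_empty : r ∅ = 0)
    (h_le : ∀ X ⊆ E, ∀ a ∈ E, r X ≤ r (insert a X))
    (h_le_add : ∀ X ⊆ E, ∀ a ∈ E, r (insert a X) ≤ r X + 1)
    (h_loc : ∀ X ⊆ E, ∀ a ∈ E, ∀ b ∈ E, r (insert a X) = r X → r (insert b X) = r X →
      r (insert a (insert b X)) = r X) :
    ∃ N : Matroid α, N.E = E ∧ ∀ I, N.Indep I ↔ I ⊆ E ∧ r I = I.ncard := by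
  have h_mono : ∀ X Y, X ⊆ E → Y ⊆ E → r X ≤ r (X ∪ Y) ∧ r (X ∪ Y) ≤ r X + Y.ncard := by
    intro X Y hX hY
    have hYfin := hE.subset hY
    induction Y, hYfin using Set.Finite.induction_on with
    | empty => simp
    | @insert a Y haY hYfin ih =>
      rw [insert_subset_iff] at hY
      rw [union_insert, ncard_insert_of_notMem haY hYfin]
      have h1 := h_le (X ∪ Y) (union_subset hX hY.2) a hY.1
      have h2 := h_le_add (X ∪ Y) (union_subset hX hY.2) a hY.1
      have := ih hY.2
      push_cast
      omega
  have h_card : ∀ X ⊆ E, r X ≤ X.ncard := by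
    intro X hX
    have := (h_mono ∅ X (empty_subset E) hX).2
    rw [empty_union] at this
    omega
  refine ⟨(IndepMatroid.ofFinite hE (fun I ↦ I ⊆ E ∧ r I = I.ncard) (by simp [h_empty]) ?_ ?_
    (fun I h ↦ h.1)).matroid, rfl, fun I ↦ Iff.rfl⟩
  · rintro I J ⟨hJ, hJr⟩ hIJ
    refine ⟨hIJ.trans hJ, ?_⟩
    have h1 := (h_mono I (J \ I) (hIJ.trans hJ) (sdiff_subset.trans hJ)).2
    rw [union_sdiff_cancel hIJ] at h1
    have h2 := ncard_sdiff_add_ncard_of_subset hIJ (hE.subset hJ)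
    have h3 := h_card I (hIJ.trans hJ)
    omega
  · rintro I J ⟨hI, hIr⟩ ⟨hJ, hJr⟩ hlt
    -- If no element of `J` augments `I`, none raises its rank, so `r (I ∪ J) = |I| < |J| = r J`,
    -- against monotonicity.
    by_contra! hcon
    have key : r (I ∪ J) = r I := by
      refine rank_union_eq_of_forall_insert hE h_loc hI hJ fun a ha ↦ ?_
      by_cases haI : a ∈ I
      · rw [insert_eq_of_mem haI]
      have h1 := hcon a ha haI (insert_subset (hJ ha) hI)
      rw [ncard_insert_of_notMem haI (hE.subset hI)] at h1
      have h2 := h_le I hI a (hJ ha)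
      have h3 := h_le_add I hI a (hJ ha)
      push_cast at h1
      omega
    have h1 := (h_mono J I hJ hI).1
    rw [union_comm] at h1
    omega

/-- A single-element extension from the local axioms for the family of sets that are to span the
new element. -/
theorem exists_extension_of_spans (M : Matroid α) [M.Finite] {p : α} (hp : p ∉ M.E)
    (P : Set α → Prop)
    (h_mono : ∀ X ⊆ M.E, ∀ a ∈ M.E, P X → P (insert a X))
    (h_cl : ∀ X ⊆ M.E, ∀ a ∈ M.E, M.rkNat (insert a X) = M.rkNat X → P (insert a X) → P X)
    (h_mod : ∀ X ⊆ M.E, ∀ a ∈ M.E, ∀ b ∈ M.E, ¬ P X → P (insert a X) → P (insert b X) →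
      M.rkNat (insert a (insert b X)) ≤ M.rkNat X + 1) :
    ∃ N : Matroid α, N.IsExtensionBy M {p} ∧
      ∀ I ⊆ M.E, N.Indep (insert p I) ↔ M.Indep I ∧ ¬ P I := by
  classical
  set r : Set α → ℤ := fun X ↦ M.rkNat (X \ {p}) + if p ∈ X ∧ ¬ P (X \ {p}) then 1 else 0 with hr
  have r1 : ∀ X ⊆ M.E, r X = M.rkNat X := by
    intro X hX
    have : p ∉ X := fun h ↦ hp (hX h)
    simp [hr, this]
  have r2 : ∀ X ⊆ M.E, r (insert p X) = M.rkNat X + if P X then 0 else 1 := by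
    intro X hX
    have : p ∉ X := fun h ↦ hp (hX h)
    by_cases hPX : P X <;> simp [hr, this, hPX]
  have hcases : ∀ X ⊆ insert p M.E, X ⊆ M.E ∨ ∃ X₀ ⊆ M.E, X = insert p X₀ := by
    intro X hX
    by_cases hpX : p ∈ X
    · exact .inr ⟨X \ {p}, by simpa [sdiff_subset_iff] using hX, by simp [hpX]⟩
    · exact .inl ((subset_insert_iff_of_notMem hpX).1 hX)
  have hstep : ∀ X ⊆ M.E, ∀ a ∈ M.E, M.rkNat X ≤ M.rkNat (insert a X) ∧
      M.rkNat (insert a X) ≤ M.rkNat X + 1 ∧ (P X → P (insert a X)) ∧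
      (M.rkNat (insert a X) = M.rkNat X → P (insert a X) → P X) := fun X hX a ha ↦
    ⟨M.rkNat_le_insert a X, M.rkNat_insert_le a X, h_mono X hX a ha, h_cl X hX a ha⟩
  have hunit : ∀ X ⊆ insert p M.E, ∀ a ∈ insert p M.E,
      r X ≤ r (insert a X) ∧ r (insert a X) ≤ r X + 1 := by
    rintro X hX' a ha
    obtain hX | ⟨X, hX, rfl⟩ := hcases X hX'
    · obtain rfl | ha := ha
      · rw [r2 X hX, r1 X hX]
        split_ifs <;> omega
      · rw [r1 X hX, r1 _ (insert_subset ha hX)]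
        have := hstep X hX a ha
        omega
    · obtain rfl | ha := ha
      · rw [insert_idem]
        omega
      · rw [insert_comm, r2 X hX, r2 _ (insert_subset ha hX)]
        obtain ⟨h1, h2, h3, h4⟩ := hstep X hX a ha
        by_cases h : P X
        · rw [if_pos h, if_pos (h3 h)]
          omega
        by_cases h' : P (insert a X)
        · have : M.rkNat (insert a X) ≠ M.rkNat X := fun e ↦ h (h4 e h')
          rw [if_neg h, if_pos h']
          omega
        · rw [if_neg h, if_neg h']
          omega
  obtain ⟨N, hNE, hN⟩ := exists_of_rank (E := insert p M.E) (r := r) (M.ground_finite.insert p)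
    (by rw [r1 ∅ (empty_subset _)]; simp) (fun X hX a ha ↦ (hunit X hX a ha).1)
    (fun X hX a ha ↦ (hunit X hX a ha).2) (by
      have hloc : ∀ X ⊆ M.E, ∀ a ∈ M.E, ∀ b ∈ M.E, M.rkNat (insert a X) = M.rkNat X →
          M.rkNat (insert b X) = M.rkNat X → M.rkNat (insert a (insert b X)) = M.rkNat X := by
        intro X hX a ha b hb h1 h2
        have h3 := M.rkNat_insert_add_le (subset_insert b X) a
        have h4 := M.rkNat_le_insert a (insert b X)
        omega
      have hp1 : ∀ X ⊆ M.E, ∀ b ∈ M.E, r (insert p X) = r X → r (insert b X) = r X →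
          r (insert p (insert b X)) = r X := by
        intro X hX b hb h1 h2
        rw [r2 X hX, r1 X hX] at h1
        have hPX : P X := by
          by_contra h
          simp [h] at h1
        rw [r1 _ (insert_subset hb hX)] at h2
        rw [r2 _ (insert_subset hb hX), if_pos (h_mono X hX b hb hPX)]
        omega
      intro X hX' a ha b hb h1 h2
      obtain hX | ⟨X, hX, rfl⟩ := hcases X hX'
      · obtain rfl | ha := ha
        · obtain rfl | hb := hb
          · rwa [insert_idem]
          · exact hp1 X hX b hb h1 h2
        · obtain rfl | hb := hb
          · rw [insert_comm]
            exact hp1 X hX a ha h2 h1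
          · rw [r1 X hX, r1 _ (insert_subset ha hX)] at h1
            rw [r1 X hX, r1 _ (insert_subset hb hX)] at h2
            rw [r1 X hX, r1 _ (insert_subset ha (insert_subset hb hX))]
            have := hloc X hX a ha b hb (by omega) (by omega)
            omega
      · obtain rfl | ha := ha
        · rw [insert_eq_of_mem (mem_insert_of_mem b (mem_insert a X)), h2]
        obtain rfl | hb := hb
        · rw [insert_idem, h1]
        rw [insert_comm, r2 X hX, r2 _ (insert_subset ha hX)] at h1
        rw [insert_comm, r2 X hX, r2 _ (insert_subset hb hX)] at h2
        rw [insert_comm b, insert_comm a, r2 X hX, r2 _ (insert_subset ha (insert_subset hb hX))]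
        obtain ⟨a1, a2, a3, a4⟩ := hstep X hX a ha
        obtain ⟨b1, b2, b3, b4⟩ := hstep X hX b hb
        obtain ⟨c1, c2, c3, c4⟩ := hstep _ (insert_subset hb hX) a ha
        obtain ⟨d1, d2, d3, d4⟩ := hstep _ (insert_subset ha hX) b hb
        rw [insert_comm b a] at d1 d2 d3 d4
        have e := h_mod X hX a ha b hb
        have e' := M.rkNat_insert_add_le (subset_insert b X) a
        by_cases hP : P X
        · simp only [hP, a3 hP, b3 hP, c3 (b3 hP), if_true] at *
          omega
        by_cases hPa : P (insert a X)
        · by_cases hPb : P (insert b X)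
          · simp only [hP, hPa, hPb, c3 hPb, if_true, if_false] at *
            specialize e not_false trivial trivial
            omega
          · simp only [hP, hPa, hPb, d3 hPa, if_true, if_false] at *
            omega
        · by_cases hPb : P (insert b X)
          · simp only [hP, hPa, hPb, c3 hPb, if_true, if_false] at *
            omega
          · by_cases hPab : P (insert a (insert b X))
            · simp only [hP, hPa, hPb, hPab, if_true, if_false] at *
              exact absurd (c4 (by omega) trivial) not_false
            · simp only [hP, hPa, hPb, hPab, if_false] at *
              omega)
  refine ⟨N, ⟨by simpa using hp, by rw [hNE, union_singleton], ?_⟩, ?_⟩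
  · refine ext_indep (by simp [hNE, hp]) fun I hI ↦ ?_
    have hIE : I ⊆ M.E := by
      rw [delete_ground, hNE] at hI
      exact hI.trans (by simp [sdiff_subset_iff])
    rw [delete_indep_iff, hN, r1 I hIE, M.indep_iff_rkNat hIE, disjoint_singleton_right]
    have : p ∉ I := fun h ↦ hp (hIE h)
    simp [this, hIE.trans (subset_insert p M.E)]
  · intro I hI
    have hpI : p ∉ I := fun h ↦ hp (hI h)
    rw [hN, M.indep_iff_rkNat hI, r2 I hI,
      ncard_insert_of_notMem hpI (M.ground_finite.subset hI)]
    have h1 : (M.rkNat I : ℕ∞) ≤ I.encard := by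
      rw [coe_rkNat]
      exact M.eRk_le_encard I
    rw [← (M.ground_finite.subset hI).cast_ncard_eq] at h1
    norm_cast at h1
    have h2 : insert p I ⊆ insert p M.E := insert_subset_insert hI
    by_cases hPI : P I
    · simp only [hPI, if_true, not_true, and_false, iff_false, not_and]
      push_cast
      omega
    · simp only [hPI, if_false, h2, true_and, not_false_iff, and_true]
      push_cast
      omega

end OfRank

end Matroid

/-! ### Strand pairs, and existence of the point from coherence -/

namespace Matroid

/-- `(A, B)` partitions the ground set with `⊓(A, B) = 2`, and `S`, `T` are strands on its two sides
with `⊓(S, T) = 1`. -/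
structure IsStrandPair {α : Type*} (M : Matroid α) (A B S T : Set α) : Prop where
  disjoint : Disjoint A B
  union_eq : A ∪ B = M.E
  conn_eq : M.localConn A B = 2
  left : M.IsStrand A B S
  right : M.IsStrand B A T
  conn_strands : M.localConn S T = 1

/-- `N` extends `M` by an element `p` that completes both `S` and `T` to circuits. -/
structure IsPointExtension {α : Type*} (N M : Matroid α) (S T : Set α) (p : α) : Prop where
  extension : N.IsExtensionBy M {p}
  left : N.IsCircuit (insert p S)
  right : N.IsCircuit (insert p T)

/-- For subsets `G` of `A` and `F` of `B` that meet the guts in a point, any two of the following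
imply the third: `G` and `F` meet the guts in the same point; `G` meets the guts in the point of
`T`; `F` meets the guts in the point of `S`. -/
def IsCoherent {α : Type*} (M : Matroid α) (A B S T : Set α) : Prop :=
  ∀ G ⊆ A, ∀ F ⊆ B, M.localConn G B = 1 → M.localConn F A = 1 →
    (M.localConn G F = 1 → (M.localConn G T = 1 ↔ M.localConn F S = 1)) ∧
    (M.localConn G T = 1 → M.localConn F S = 1 → M.localConn G F = 1)

/-- The condition for `G ∪ F`, where `G ⊆ A` and `F ⊆ B`, to span the point on the guts of `(A, B)`
determined by the strands `S` and `T`. -/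
def SpansPoint {α : Type*} (M : Matroid α) (A B S T G F : Set α) : Prop :=
  M.localConn G T = 1 ∨ M.localConn F S = 1 ∨
    (M.localConn G B = 1 ∧ M.localConn F A = 1 ∧ M.localConn G F = 0)

variable {α : Type*} {M N : Matroid α} {A B S T G F X : Set α} {a b p : α}

lemma IsCoherent.symm (h : M.IsCoherent A B S T) : M.IsCoherent B A T S := by
  intro G hG F hF h1 h2
  have := h F hF G hG h2 h1
  rw [M.localConn_comm G F]
  tauto

lemma spansPoint_comm : M.SpansPoint A B S T G F ↔ M.SpansPoint B A T S F G := by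
  rw [SpansPoint, SpansPoint, M.localConn_comm G F]
  tauto

namespace IsStrandPair

lemma symm (h : M.IsStrandPair A B S T) : M.IsStrandPair B A T S where
  disjoint := h.disjoint.symm
  union_eq := by rw [union_comm, h.union_eq]
  conn_eq := by rw [localConn_comm, h.conn_eq]
  left := h.right
  right := h.left
  conn_strands := by rw [localConn_comm, h.conn_strands]

lemma subset_left (h : M.IsStrandPair A B S T) : S ⊆ A := h.left.prop.1

lemma subset_right (h : M.IsStrandPair A B S T) : T ⊆ B := h.right.prop.1

lemma conn_left (h : M.IsStrandPair A B S T) : M.localConn S B = 1 := h.left.prop.2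

lemma left_subset_ground (h : M.IsStrandPair A B S T) : A ⊆ M.E :=
  subset_union_left.trans h.union_eq.subset

variable [M.Finite]

lemma localConn_left_diff (h : M.IsStrandPair A B S T) (ha : a ∈ S) :
    M.localConn (S \ {a}) B = 0 := by
  have h1 := M.localConn_mono_left (sdiff_subset (s := S) (t := {a})) B
  have h2 := M.localConn_nonneg (S \ {a}) B
  rw [h.conn_left] at h1
  by_contra hne
  have h3 : M.localConn (S \ {a}) B = 1 := by omega
  have := h.left.le_of_le ⟨sdiff_subset.trans h.subset_left, h3⟩ sdiff_subset
  exact (this ha).2 rfl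

/-- Removing `a` lowers the connectivity to `B` from one to zero, which requires the rank to drop.
Hence strands are independent, as `S ∪ {p}` being a circuit demands. -/
lemma rkNat_left_diff (h : M.IsStrandPair A B S T) (ha : a ∈ S) :
    M.rkNat S = M.rkNat (S \ {a}) + 1 := by
  have h1 := M.localConn_insert_left a (S \ {a}) B
  have h2 := h.localConn_left_diff ha
  have h3 := M.rkNat_insert_le a (S \ {a})
  have h4 := M.rkNat_le_insert a (S \ {a} ∪ B)
  rw [insert_sdiff_singleton, insert_eq_of_mem ha, h.conn_left] at h1
  rw [insert_sdiff_singleton, insert_eq_of_mem ha] at h3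
  simp only [localConn] at h2
  omega

lemma indep_left (h : M.IsStrandPair A B S T) : M.Indep S := by
  rw [indep_iff_forall_notMem_closure_sdiff (h.subset_left.trans h.left_subset_ground)]
  intro a ha hcl
  rw [mem_closure_iff_rkNat _ (h.left_subset_ground (h.subset_left ha)), insert_sdiff_singleton,
    insert_eq_of_mem ha] at hcl
  have := h.rkNat_left_diff ha
  omega

omit [M.Finite] in
lemma left_nonempty (h : M.IsStrandPair A B S T) : S.Nonempty := by
  rw [nonempty_iff_ne_empty]
  rintro rfl
  simpa using h.conn_left

omit [M.Finite] in
lemma conn_right_full (h : M.IsStrandPair A B S T) : M.localConn A T = 1 := by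
  rw [localConn_comm, h.symm.conn_left]

lemma localConn_bounds (h : M.IsStrandPair A B S T) (hG : G ⊆ A) :
    0 ≤ M.localConn G T ∧ M.localConn G T ≤ 1 ∧ M.localConn G T ≤ M.localConn G B ∧
    M.localConn G B ≤ 2 := by
  refine ⟨M.localConn_nonneg G T, ?_, M.localConn_mono Subset.rfl h.subset_right, ?_⟩
  · rw [← h.conn_right_full]
    exact M.localConn_mono_left hG T
  · rw [← h.conn_eq]
    exact M.localConn_mono_left hG B

/-- Connectivity two means having the whole guts line, and then `B` cannot tell `G` from `A`. -/
lemma localConn_eq_of_eq_two (h : M.IsStrandPair A B S T) (hG : G ⊆ A)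
    (h2 : M.localConn G B = 2) (hF : F ⊆ B) : M.localConn G F = M.localConn A F :=
  M.localConn_eq_of_full hG hF (by rw [h2, h.conn_eq])

lemma localConn_right_eq_of_eq_two (h : M.IsStrandPair A B S T) (hG : G ⊆ A)
    (h2 : M.localConn G B = 2) : M.localConn G T = 1 := by
  rw [h.localConn_eq_of_eq_two hG h2 h.subset_right, h.conn_right_full]

lemma localConn_le (_ : M.IsStrandPair A B S T) (hG : G ⊆ A) (hF : F ⊆ B) :
    0 ≤ M.localConn G F ∧ M.localConn G F ≤ M.localConn A F ∧
    M.localConn G F ≤ M.localConn G B :=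
  ⟨M.localConn_nonneg G F, M.localConn_mono_left hG F, M.localConn_mono Subset.rfl hF⟩

end IsStrandPair

/-- The change of the connectivity to a set `F ⊆ B` under adding an element `a` to `G`. -/
lemma localConn_insert_diff [M.Finite] (hF : F ⊆ B) (a : α) (G : Set α) :
    M.localConn (insert a G) F = M.localConn G F +
      (M.rkNat (insert a G) - M.rkNat G) - (M.rkNat (insert a (G ∪ F)) - M.rkNat (G ∪ F)) ∧
    (M.rkNat (insert a (G ∪ F)) : ℤ) - M.rkNat (G ∪ F) ≤ M.rkNat (insert a G) - M.rkNat G ∧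
    (M.rkNat (insert a (G ∪ B)) : ℤ) - M.rkNat (G ∪ B) ≤
      M.rkNat (insert a (G ∪ F)) - M.rkNat (G ∪ F) ∧
    (M.rkNat (insert a G) : ℤ) ≤ M.rkNat G + 1 ∧
    (M.rkNat (G ∪ B) : ℤ) ≤ M.rkNat (insert a (G ∪ B)) := by
  have h1 := M.rkNat_insert_add_le (subset_union_left (s := G) (t := F)) a
  have h2 := M.rkNat_insert_add_le (union_subset_union_right G hF) a
  have h3 := M.rkNat_insert_le a G
  have h4 := M.rkNat_le_insert a (G ∪ B)
  rw [localConn_insert_left, localConn]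
  omega

/-- Each of `a`, `b` raises the rank of `G` but not of `G ∪ F`, so neither raises the latter in the
presence of the other. -/
lemma localConn_insert_insert [M.Finite] (hr : M.rkNat G + 2 ≤ M.rkNat (insert a (insert b G)))
    (ha : M.localConn (insert a G) F = M.localConn G F + 1)
    (hb : M.localConn (insert b G) F = M.localConn G F + 1) :
    M.localConn (insert a (insert b G)) F = M.localConn G F + 2 := by
  have h1 := M.rkNat_insert_add_le (subset_insert b (G ∪ F)) a
  have h2 := M.rkNat_le_insert a (insert b (G ∪ F))
  have h3 := M.rkNat_insert_le a (insert b G)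
  have h4 := M.rkNat_insert_le b G
  have h5 := M.rkNat_insert_le a G
  have h6 := M.rkNat_le_insert a (G ∪ F)
  have h7 := M.rkNat_le_insert b (G ∪ F)
  simp only [localConn, insert_union] at *
  omega

namespace IsStrandPair

variable [M.Finite]

/-- Only the clause of two distinct points needs care: either `G` gains the whole line, or its
connectivity to `B`, and hence to `F`, does not grow. -/
lemma spansPoint_insert (h : M.IsStrandPair A B S T) (hG : G ⊆ A) (hF : F ⊆ B) (ha : a ∈ A)
    (hP : M.SpansPoint A B S T G F) : M.SpansPoint A B S T (insert a G) F := by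
  have hG' : insert a G ⊆ A := insert_subset ha hG
  have m1 := M.localConn_mono_left (subset_insert a G) T
  have m2 := M.localConn_mono_left (subset_insert a G) B
  have b1 := h.localConn_bounds hG'
  have b2 := h.localConn_right_eq_of_eq_two hG'
  have i1 := M.localConn_insert_diff hF a G
  have i2 := M.localConn_insert_diff (subset_refl B) a G
  have n := M.localConn_nonneg (insert a G) F
  simp only [SpansPoint] at *
  omega

/-- As `G ∪ F` spans `a`, the connectivities of `G` to `F` and to `B` grow by the same amount. If
they grow from a `G` without a point, the new point is shared with `F`, and coherence (or `F` having
the line) passes it to `F`. If `G` had a point, it now has the line, and its old point was distinct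
from that of `F` unless `F` has the line. -/
lemma spansPoint_of_insert (h : M.IsStrandPair A B S T) (hc : M.IsCoherent A B S T) (hG : G ⊆ A)
    (hF : F ⊆ B) (ha : a ∈ A) (hr : M.rkNat (insert a (G ∪ F)) = M.rkNat (G ∪ F))
    (hP : M.SpansPoint A B S T (insert a G) F) : M.SpansPoint A B S T G F := by
  have hG' : insert a G ⊆ A := insert_subset ha hG
  have b1 := h.localConn_bounds hG
  have b2 := h.localConn_right_eq_of_eq_two hG
  have b1' := h.localConn_bounds hG'
  have b2' := h.localConn_right_eq_of_eq_two hG'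
  have f1 := h.symm.localConn_bounds hF
  have f2 := h.symm.localConn_right_eq_of_eq_two hF
  have e2 := fun x ↦ h.localConn_eq_of_eq_two hG' x hF
  have i1 := M.localConn_insert_diff hF a G
  have i2 := M.localConn_insert_diff (subset_refl B) a G
  have i3 := M.localConn_insert_diff h.subset_right a G
  have n := h.localConn_le hG hF
  have na := h.localConn_le hG' hF
  have c := hc (insert a G) hG' F hF
  rw [M.localConn_comm A F] at *
  simp only [SpansPoint] at *
  omega

/-- If the rank rose by two, the connectivity to `F` would stay fixed. Both elements cannot raise
the connectivity to `T`, which is at most one. Otherwise `F` has a point, `G` has none, and `a`, `b`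
together give `G` the whole line, which must meet `F`. -/
lemma rkNat_insert_insert_le (h : M.IsStrandPair A B S T) (hG : G ⊆ A) (hF : F ⊆ B)
    (ha : a ∈ A) (hb : b ∈ A) (hP : ¬ M.SpansPoint A B S T G F)
    (hPa : M.SpansPoint A B S T (insert a G) F) (hPb : M.SpansPoint A B S T (insert b G) F) :
    M.rkNat (insert a (insert b (G ∪ F))) ≤ M.rkNat (G ∪ F) + 1 := by
  have hGa : insert a G ⊆ A := insert_subset ha hG
  have hGb : insert b G ⊆ A := insert_subset hb hG
  have hGab : insert a (insert b G) ⊆ A := insert_subset ha hGb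
  by_contra hcon
  obtain ⟨hr, qa, qb, qab⟩ : M.rkNat G + 2 ≤ M.rkNat (insert a (insert b G)) ∧
      M.localConn (insert a G) F = M.localConn G F ∧
      M.localConn (insert b G) F = M.localConn G F ∧
      M.localConn (insert a (insert b G)) F = M.localConn G F := by
    have h1 := M.rkNat_insert_add_le (subset_insert b (G ∪ F)) a
    have h2 := M.rkNat_insert_le b (G ∪ F)
    have h3 := M.rkNat_insert_le a (insert b (G ∪ F))
    have h4 := M.rkNat_insert_le a G
    have h5 := M.rkNat_insert_le b G
    have h6 := M.rkNat_insert_le a (insert b G)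
    have h7 := M.rkNat_insert_add_le (subset_union_left (s := G) (t := F)) a
    have h8 := M.rkNat_insert_add_le (subset_union_left (s := G) (t := F)) b
    have h9 := M.rkNat_insert_add_le (insert_subset_insert (subset_union_left (s := G) (t := F))
      (a := b)) a
    simp only [localConn, insert_union]
    omega
  have full : M.localConn F A = 1 → M.localConn G F = 0 →
      M.localConn (insert a (insert b G)) B ≠ 2 := by
    intro hFA h0 h2
    rw [← qab, h.localConn_eq_of_eq_two hGab h2 hF, localConn_comm] at h0
    omega
  simp only [SpansPoint, not_or] at hP hPa hPb
  rw [or_iff_right hP.2.1] at hPa hPb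
  have b0 := h.localConn_bounds hG
  have ba := h.localConn_bounds hGa
  have bb := h.localConn_bounds hGb
  have ma := M.localConn_mono_left (subset_insert a G) B
  have mb := M.localConn_mono_left (subset_insert b G) B
  have mab := M.localConn_mono_left (subset_insert a (insert b G)) B
  have mab' := M.localConn_mono_left (insert_subset_insert (subset_insert b G) (a := a)) B
  have bab := h.localConn_bounds hGab
  have dbl := M.localConn_insert_insert hr (F := B)
  rcases hPa with hPa | hPa <;> rcases hPb with hPb | hPb
  · have := M.localConn_insert_insert hr (F := T) (by omega) (by omega)
    omega
  · have := full hPb.2.1 (by omega)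
    have h0 : M.localConn G B = 0 := by omega
    have := dbl (by omega) (by omega)
    omega
  · have := full hPa.2.1 (by omega)
    have h0 : M.localConn G B = 0 := by omega
    have := dbl (by omega) (by omega)
    omega
  · have := full hPa.2.1 (by omega)
    have h0 : M.localConn G B = 0 := by omega
    have := dbl (by omega) (by omega)
    omega

/-- If `G` and `F` meet the guts in a point, and `a` raises the connectivity of `G` to `T`, then
`insert a G` meets the guts in a line, so has positive connectivity to `F`. -/
lemma localConn_insert_ne_zero (h : M.IsStrandPair A B S T) (hG : G ⊆ A) (hF : F ⊆ B) (ha : a ∈ A)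
    (hGB : M.localConn G B = 1) (hGT : M.localConn G T ≠ 1) (hT : M.localConn (insert a G) T = 1)
    (hFA : M.localConn F A = 1) : M.localConn (insert a G) F ≠ 0 := by
  have hGa : insert a G ⊆ A := insert_subset ha hG
  have i1 := M.localConn_insert_diff (subset_refl B) a G
  have i2 := M.localConn_insert_diff h.subset_right a G
  have b0 := h.localConn_bounds hG
  rw [h.localConn_eq_of_eq_two hGa (by omega) hF, localConn_comm, hFA]
  exact one_ne_zero

/-- If the rank rose by two, `G` or `insert a G` against `F` or `insert b F` would all have the same
connectivity. When both enlarged sets reach the point of the strands, they meet, so `G` and `F`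
already do, and coherence or fullness puts that point in `G` or `F`. -/
lemma rkNat_insert_insert_le' (h : M.IsStrandPair A B S T) (hc : M.IsCoherent A B S T)
    (hG : G ⊆ A) (hF : F ⊆ B) (ha : a ∈ A) (hb : b ∈ B) (hP : ¬ M.SpansPoint A B S T G F)
    (hPa : M.SpansPoint A B S T (insert a G) F) (hPb : M.SpansPoint A B S T G (insert b F)) :
    M.rkNat (insert a (insert b (G ∪ F))) ≤ M.rkNat (G ∪ F) + 1 := by
  have hGa : insert a G ⊆ A := insert_subset ha hG
  have hFb : insert b F ⊆ B := insert_subset hb hF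
  by_contra hcon
  obtain ⟨qa, qb, qab⟩ : M.localConn (insert a G) F = M.localConn G F ∧
      M.localConn G (insert b F) = M.localConn G F ∧
      M.localConn (insert a G) (insert b F) = M.localConn G F := by
    have h1 := M.rkNat_insert_add_le (subset_insert b (G ∪ F)) a
    have h2 := M.rkNat_insert_le b (G ∪ F)
    have h3 := M.rkNat_insert_le a (insert b (G ∪ F))
    have h4 := M.rkNat_insert_le a G
    have h5 := M.rkNat_insert_le b F
    have h7 := M.rkNat_insert_add_le (subset_union_left (s := G) (t := F)) a
    have h8 := M.rkNat_insert_add_le (subset_union_right (s := G) (t := F)) b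
    simp only [localConn, insert_union, union_insert, insert_comm b a]
    omega
  have fullG : M.localConn (insert a G) B = 2 → M.localConn G F = M.localConn (insert b F) A ∧
      M.localConn G F = M.localConn F A := by
    intro h2
    rw [M.localConn_comm _ A, M.localConn_comm _ A, ← h.localConn_eq_of_eq_two hGa h2 hF,
      ← h.localConn_eq_of_eq_two hGa h2 hFb]
    omega
  have fullF : M.localConn (insert b F) A = 2 → M.localConn G F = M.localConn (insert a G) B ∧
      M.localConn G F = M.localConn G B := by
    intro h2
    rw [M.localConn_comm _ B, M.localConn_comm _ B, ← h.symm.localConn_eq_of_eq_two hFb h2 hG,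
      ← h.symm.localConn_eq_of_eq_two hFb h2 hGa, M.localConn_comm (insert b F),
      M.localConn_comm (insert b F)]
    omega
  simp only [SpansPoint, not_or] at hP hPa hPb
  rw [or_iff_right hP.2.1] at hPa
  rw [or_iff_right hP.1] at hPb
  rcases hPa with hPa | hPa <;> rcases hPb with hPb | hPb
  · have ba := h.localConn_bounds hGa
    have bb := h.symm.localConn_bounds hFb
    have e1 := mt (h.localConn_right_eq_of_eq_two hG) hP.1
    have e2 := mt (h.symm.localConn_right_eq_of_eq_two hF) hP.2.1
    have b0 := h.localConn_bounds hG
    have f0 := h.symm.localConn_bounds hF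
    have n1 := h.localConn_le hG hF
    have n2 := h.symm.localConn_le hF hG
    rw [M.localConn_comm F G] at n2
    have hA : M.localConn (insert a G) B = 1 → M.localConn G F ≠ 1 := fun h1 h2 ↦
      hP.2.1 <| ((hc _ hGa _ hF h1 (by omega)).1 (by omega)).1 hPa
    have hB : M.localConn (insert b F) A = 1 → M.localConn G F ≠ 1 := fun h1 h2 ↦
      hP.1 <| ((hc _ hG _ hFb (by omega) h1).1 (by omega)).2 hPb
    by_cases g1 : M.localConn (insert a G) B = 1
    · have := hA g1
      by_cases f1 : M.localConn (insert b F) A = 1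
      · have := (hc _ hGa _ hFb g1 f1).2 hPa hPb
        omega
      · have := fullF (by omega)
        omega
    · have := fullG (by omega)
      have := h.symm.localConn_le hFb hG
      by_cases f1 : M.localConn (insert b F) A = 1
      · have := hB f1
        omega
      · omega
  · exact h.localConn_insert_ne_zero hG hFb ha hPb.1 hP.1 hPa hPb.2.1 (by omega)
  · refine h.symm.localConn_insert_ne_zero hF hGa hb hPa.2.1 hP.2.1 hPb hPa.1 ?_
    rw [localConn_comm]
    omega
  · exact hP.2.2 ⟨hPb.1, hPa.2.1, by omega⟩

/-- Coherence suffices for the existence of the extension. -/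
theorem exists_isPointExtension (h : M.IsStrandPair A B S T) (hc : M.IsCoherent A B S T)
    (hp : p ∉ M.E) : ∃ N : Matroid α, N.IsPointExtension M S T p := by
  have hcap : ∀ {A B : Set α} {a X}, Disjoint A B → a ∈ A →
      insert a X ∩ A = insert a (X ∩ A) ∧ insert a X ∩ B = X ∩ B := fun hd ha ↦
    ⟨insert_inter_of_mem ha, insert_inter_of_notMem (hd.notMem_of_mem_left ha)⟩
  have hcapA := fun {a X} ↦ hcap (a := a) (X := X) h.disjoint
  have hcapB := fun {a X} ↦ hcap (a := a) (X := X) h.disjoint.symm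
  have hX : ∀ X ⊆ M.E, X = X ∩ A ∪ X ∩ B := by
    intro X hX
    rw [← inter_union_distrib_left, h.union_eq, inter_eq_self_of_subset_left hX]
  have hmem : ∀ a ∈ M.E, a ∈ A ∨ a ∈ B := fun a ha ↦ by rwa [← h.union_eq] at ha
  obtain ⟨N, hN, hind⟩ := M.exists_extension_of_spans hp
    (fun X ↦ M.SpansPoint A B S T (X ∩ A) (X ∩ B)) (by
      intro X _ a ha hP
      obtain ha | ha := hmem a ha
      · rw [(hcapA ha).1, (hcapA ha).2]
        exact h.spansPoint_insert inter_subset_right inter_subset_right ha hP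
      · rw [(hcapB ha).1, (hcapB ha).2, spansPoint_comm]
        exact h.symm.spansPoint_insert inter_subset_right inter_subset_right ha
          (spansPoint_comm.1 hP)) (by
      intro X hXE a ha hr hP
      rw [hX X hXE] at hr
      obtain ha | ha := hmem a ha
      · rw [(hcapA ha).1, (hcapA ha).2] at hP
        exact h.spansPoint_of_insert hc inter_subset_right inter_subset_right ha hr hP
      · rw [(hcapB ha).1, (hcapB ha).2, spansPoint_comm] at hP
        rw [union_comm] at hr
        exact spansPoint_comm.1 <|
          h.symm.spansPoint_of_insert hc.symm inter_subset_right inter_subset_right ha hr hP) (by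
      intro X hXE a ha b hb hP hPa hPb
      rw [hX X hXE]
      obtain ha | ha := hmem a ha <;> obtain hb | hb := hmem b hb
      · rw [(hcapA ha).1, (hcapA ha).2] at hPa
        rw [(hcapA hb).1, (hcapA hb).2] at hPb
        exact h.rkNat_insert_insert_le inter_subset_right inter_subset_right ha hb hP hPa hPb
      · rw [(hcapA ha).1, (hcapA ha).2] at hPa
        rw [(hcapB hb).1, (hcapB hb).2] at hPb
        exact h.rkNat_insert_insert_le' hc inter_subset_right inter_subset_right ha hb hP hPa hPb
      · rw [(hcapB ha).1, (hcapB ha).2] at hPa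
        rw [(hcapA hb).1, (hcapA hb).2] at hPb
        rw [insert_comm]
        exact h.rkNat_insert_insert_le' hc inter_subset_right inter_subset_right hb ha hP hPb hPa
      · rw [(hcapB ha).1, (hcapB ha).2, spansPoint_comm] at hPa
        rw [(hcapB hb).1, (hcapB hb).2, spansPoint_comm] at hPb
        rw [spansPoint_comm] at hP
        rw [union_comm]
        exact h.symm.rkNat_insert_insert_le inter_subset_right inter_subset_right ha hb hP hPa hPb)
  -- Taking `F = ∅` leaves only the first clause of `SpansPoint`, so minimality of the strand gives
  -- the circuit. The sides are quantified anew so that this serves `S` and `T` alike.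
  have hcirc : ∀ {A B S T}, M.IsStrandPair A B S T → (∀ I ⊆ A, N.Indep (insert p I) ↔
      M.Indep I ∧ ¬ M.SpansPoint A B S T I ∅) → N.IsCircuit (insert p S) := by
    intro A B S T h hA
    have hI := h.indep_left
    have hpS : p ∉ S := fun hpS ↦ hp (hI.subset_ground hpS)
    have hSN : N.Indep S := by
      rw [← hN.delete_eq] at hI
      exact hI.of_delete
    rw [isCircuit_iff_dep_forall_sdiff_singleton_indep, dep_iff]
    refine ⟨⟨fun hi ↦ ((hA S h.subset_left).1 hi).2 (.inl h.conn_strands), ?_⟩, ?_⟩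
    · rw [hN.ground_eq, union_singleton]
      exact insert_subset_insert hI.subset_ground
    rintro a (rfl | ha)
    · rwa [insert_sdiff_self_of_notMem hpS]
    rw [← insert_sdiff_singleton_comm (by rintro rfl; exact hpS ha),
      hA _ (sdiff_subset.trans h.subset_left)]
    refine ⟨hI.subset sdiff_subset, ?_⟩
    have h1 := h.localConn_left_diff ha
    have h2 := h.localConn_bounds ((sdiff_subset (s := S) (t := {a})).trans h.subset_left)
    simp only [SpansPoint, localConn_empty_left, zero_ne_one, false_and, and_false, or_false]
    omega
  refine ⟨N, hN, hcirc h fun I hI ↦ ?_, hcirc h.symm fun I hI ↦ ?_⟩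
  · rw [hind I (hI.trans h.left_subset_ground), inter_eq_self_of_subset_left hI,
      (h.disjoint.mono_left hI).inter_eq]
  · rw [hind I (hI.trans h.symm.left_subset_ground), inter_eq_self_of_subset_left hI,
      (h.disjoint.symm.mono_left hI).inter_eq, spansPoint_comm]

end IsStrandPair
end Matroid

/-! ### A point extension is determined by `M` and forces coherence -/

namespace Matroid

variable {α : Type*} {M N N' : Matroid α} {A B S T G F X P : Set α} {a b p : α}

namespace IsExtensionBy

lemma ground_subset (hN : N.IsExtensionBy M P) : M.E ⊆ N.E := by
  rw [hN.ground_eq]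
  exact subset_union_left

lemma finite [M.Finite] (hN : N.IsExtensionBy M P) (hP : P.Finite) : N.Finite :=
  ⟨by rw [hN.ground_eq]; exact M.ground_finite.union hP⟩

lemma rkNat_eq (hN : N.IsExtensionBy M P) (hX : X ⊆ M.E) : N.rkNat X = M.rkNat X := by
  have h : N.E \ P = M.E := by
    rw [hN.ground_eq, union_sdiff_right, hN.disjoint.sdiff_eq_left]
  have h2 := hN.delete_eq
  rw [delete_eq_restrict, h] at h2
  rw [rkNat, rkNat, ← h2, restrict_eRk_eq _ hX]

lemma localConn_eq (hN : N.IsExtensionBy M P) (hX : X ⊆ M.E) (hF : F ⊆ M.E) :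
    N.localConn X F = M.localConn X F := by
  rw [localConn, localConn, hN.rkNat_eq hX, hN.rkNat_eq hF, hN.rkNat_eq (union_subset hX hF)]

lemma indep_iff (hN : N.IsExtensionBy M P) (hX : X ⊆ M.E) : N.Indep X ↔ M.Indep X := by
  conv_rhs => rw [← hN.delete_eq]
  rw [delete_indep_iff, and_iff_left (hN.disjoint.mono_left hX)]

lemma isCircuit_iff (hN : N.IsExtensionBy M P) (hX : X ⊆ M.E) : N.IsCircuit X ↔ M.IsCircuit X := by
  conv_rhs => rw [← hN.delete_eq]
  rw [delete_isCircuit_iff, and_iff_left (hN.disjoint.mono_left hX)]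

end IsExtensionBy

lemma IsPointExtension.symm (h : N.IsPointExtension M S T p) : N.IsPointExtension M T S p :=
  ⟨h.extension, h.right, h.left⟩

lemma rkNat_insert_eq_of_subset [N.Finite] (h : N.rkNat (insert p G) = N.rkNat G) (hGX : G ⊆ X) :
    N.rkNat (insert p X) = N.rkNat X := by
  have h1 := N.rkNat_insert_add_le hGX p
  have h2 := N.rkNat_le_insert p X
  omega

lemma IsPointExtension.rkNat_insert_left [N.Finite] (hN : N.IsPointExtension M S T p)
    (hp : p ∉ S) : N.rkNat (insert p S) = N.rkNat S := by
  have hC := hN.left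
  have h := hC.mem_closure_sdiff_singleton_of_mem (mem_insert p S)
  rw [insert_sdiff_self_of_notMem hp] at h
  exact (N.mem_closure_iff_rkNat (hC.subset_ground (mem_insert p S))).1 h

lemma IsPointExtension.rkNat_singleton [N.Finite] (hN : N.IsPointExtension M S T p)
    (hp : p ∉ S) (hS : S.Nonempty) : N.rkNat {p} = 1 := by
  obtain ⟨a, ha⟩ := hS
  have h : N.Indep {p} := hN.left.ssubset_indep <| by
    refine ⟨by simp, fun h ↦ hp ?_⟩
    have : a = p := by simpa using h (mem_insert_of_mem p ha)
    rwa [← this]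
  rw [N.indep_iff_rkNat h.subset_ground] at h
  simpa using h

namespace IsStrandPair

lemma notMem (h : M.IsStrandPair A B S T) (hN : N.IsPointExtension M S T p) (hX : X ⊆ A) :
    p ∉ X := fun hp ↦
  hN.extension.disjoint.notMem_of_mem_left (h.left_subset_ground (hX hp)) (mem_singleton p)

variable [N.Finite]

lemma rkNat_insert_left (h : M.IsStrandPair A B S T) (hN : N.IsPointExtension M S T p)
    (hSX : S ⊆ X) : N.rkNat (insert p X) = N.rkNat X :=
  rkNat_insert_eq_of_subset (hN.rkNat_insert_left (h.notMem hN h.subset_left)) hSX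

variable [M.Finite]

omit [M.Finite] in
lemma localConn_insert_full (h : M.IsStrandPair A B S T) (hN : N.IsPointExtension M S T p)
    (hF : F ⊆ B) : N.localConn (insert p A) F = M.localConn A F := by
  have hFE := hF.trans h.symm.left_subset_ground
  rw [localConn_insert_left, h.rkNat_insert_left hN h.subset_left,
    h.rkNat_insert_left hN (h.subset_left.trans subset_union_left),
    ← hN.extension.localConn_eq h.left_subset_ground hFE, localConn]

omit [M.Finite] in
-- Submodularity for `insert p G` and `insert p F`, whose intersection contains the non-loop `p`.
lemma one_le_localConn (h : M.IsStrandPair A B S T) (hN : N.IsPointExtension M S T p)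
    (hG : G ⊆ A) (hF : F ⊆ B) (hGp : N.rkNat (insert p G) = N.rkNat G)
    (hFp : N.rkNat (insert p F) = N.rkNat F) : 1 ≤ M.localConn G F := by
  rw [← hN.extension.localConn_eq (hG.trans h.left_subset_ground)
    (hF.trans h.symm.left_subset_ground)]
  have h1 := N.rkNat_submod (insert p G) (insert p F)
  have h2 : N.rkNat {p} ≤ N.rkNat (insert p G ∩ insert p F) := N.rkNat_mono (by simp)
  have h3 : N.rkNat (G ∪ F) ≤ N.rkNat (insert p G ∪ insert p F) :=
    N.rkNat_mono (union_subset_union (subset_insert p G) (subset_insert p F))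
  rw [hN.rkNat_singleton (h.notMem hN h.subset_left) h.left_nonempty] at h2
  rw [localConn]
  omega

/-- For the converse, drop some `b` from `T`: the rest is skew to `A ∪ {p}`. Were `p` outside the
span of `G`, then `G ∪ {p}` and `T \ {b}` would have joint rank `r(G) + r(T)`, exceeding the rank of
`G ∪ T`, which spans `p`. -/
lemma rkNat_insert_eq_iff (h : M.IsStrandPair A B S T) (hN : N.IsPointExtension M S T p)
    (hG : G ⊆ A) : N.rkNat (insert p G) = N.rkNat G ↔ M.localConn G T = 1 := by
  refine ⟨fun hGp ↦ ?_, fun hGT ↦ ?_⟩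
  · have h1 := h.one_le_localConn hN hG h.subset_right hGp
      (h.symm.rkNat_insert_left hN.symm Subset.rfl)
    have h2 := h.localConn_bounds hG
    omega
  · obtain ⟨b, hb⟩ := h.symm.left_nonempty
    have h1 := h.symm.localConn_left_diff hb
    rw [M.localConn_comm, ← h.localConn_insert_full hN (sdiff_subset.trans h.subset_right)] at h1
    have h2 := N.localConn_mono_left (insert_subset_insert (a := p) hG) (T \ {b})
    have h3 : N.rkNat (insert p G ∪ T \ {b}) ≤ N.rkNat (insert p (G ∪ T)) := by
      rw [← insert_union]
      exact N.rkNat_mono (union_subset_union_right _ sdiff_subset)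
    have h4 := h.symm.rkNat_insert_left hN.symm (subset_union_right (s := G) (t := T))
    have h5 := h.symm.rkNat_left_diff hb
    have h6 := N.rkNat_le_insert p G
    have hTE := h.subset_right.trans h.symm.left_subset_ground
    rw [← hN.extension.rkNat_eq hTE, ← hN.extension.rkNat_eq (sdiff_subset.trans hTE)] at h5
    rw [← hN.extension.localConn_eq (hG.trans h.left_subset_ground) hTE] at hGT
    rw [h1] at h2
    simp only [localConn] at h2 hGT
    omega

/-- A point of `G` other than `p` generates the guts line together with `p`. -/
lemma localConn_insert_eq (h : M.IsStrandPair A B S T) (hN : N.IsPointExtension M S T p)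
    (hG : G ⊆ A) (hGB : M.localConn G B = 1) (hGT : M.localConn G T ≠ 1) :
    N.rkNat (insert p G) = N.rkNat G + 1 ∧
    ∀ F ⊆ B, N.localConn (insert p G) F = M.localConn A F := by
  have h1 : N.rkNat (insert p G) = N.rkNat G + 1 := by
    rw [ne_eq, ← h.rkNat_insert_eq_iff hN hG] at hGT
    have h2 := N.rkNat_insert_le p G
    have h3 := N.rkNat_le_insert p G
    omega
  refine ⟨h1, fun F hF ↦ ?_⟩
  rw [N.localConn_eq_of_full (insert_subset_insert hG) hF, h.localConn_insert_full hN hF]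
  rw [h.localConn_insert_full hN Subset.rfl, h.conn_eq, localConn_insert_left,
    h.symm.rkNat_insert_left hN.symm (h.subset_right.trans subset_union_right), h1]
  rw [← hN.extension.localConn_eq (hG.trans h.left_subset_ground) h.symm.left_subset_ground,
    localConn] at hGB
  omega

omit [M.Finite] in
-- `B` spans `p`, so a set skew to `B` is also skew to `insert p B`.
lemma rkNat_insert_union_of_skew (h : M.IsStrandPair A B S T) (hN : N.IsPointExtension M S T p)
    (hG : G ⊆ A) (hF : F ⊆ B) (h0 : M.localConn G B = 0) :
    N.rkNat (insert p (G ∪ F)) = N.rkNat G + N.rkNat (insert p F) := by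
  rw [← hN.extension.localConn_eq (hG.trans h.left_subset_ground)
    h.symm.left_subset_ground] at h0
  have h1 := h.symm.rkNat_insert_left hN.symm h.subset_right
  have h2 := h.symm.rkNat_insert_left hN.symm (h.subset_right.trans (subset_union_right (s := G)))
  have h3 : N.localConn G (insert p F) ≤ N.localConn G (insert p B) :=
    N.localConn_mono Subset.rfl (insert_subset_insert hF)
  have h4 := N.localConn_nonneg G (insert p F)
  simp only [localConn, union_insert] at *
  omega

/-- Which sets span the new element is determined by `M`. -/
theorem rkNat_insert_union_eq_iff (h : M.IsStrandPair A B S T)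
    (hN : N.IsPointExtension M S T p) (hG : G ⊆ A) (hF : F ⊆ B) :
    N.rkNat (insert p (G ∪ F)) = N.rkNat (G ∪ F) ↔ M.SpansPoint A B S T G F := by
  have hGE := hG.trans h.left_subset_ground
  have hFE := hF.trans h.symm.left_subset_ground
  by_cases hGT : M.localConn G T = 1
  · exact iff_of_true (rkNat_insert_eq_of_subset ((h.rkNat_insert_eq_iff hN hG).2 hGT)
      subset_union_left) (.inl hGT)
  by_cases hFS : M.localConn F S = 1
  · exact iff_of_true (rkNat_insert_eq_of_subset ((h.symm.rkNat_insert_eq_iff hN.symm hF).2 hFS)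
      subset_union_right) (.inr (.inl hFS))
  rw [SpansPoint, or_iff_right hGT, or_iff_right hFS]
  have hGp := mt (h.rkNat_insert_eq_iff hN hG).1 hGT
  have hFp := mt (h.symm.rkNat_insert_eq_iff hN.symm hF).1 hFS
  have bG := h.localConn_bounds hG
  have bF := h.symm.localConn_bounds hF
  have b2 := mt (h.localConn_right_eq_of_eq_two hG) hGT
  have b2' := mt (h.symm.localConn_right_eq_of_eq_two hF) hFS
  have h1 := N.rkNat_le_insert p G
  have h2 := N.rkNat_le_insert p F
  have h3 := N.localConn_nonneg G F
  by_cases hGB : M.localConn G B = 0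
  · have := h.rkNat_insert_union_of_skew hN hG hF hGB
    rw [localConn] at h3
    omega
  by_cases hFA : M.localConn F A = 0
  · have := h.symm.rkNat_insert_union_of_skew hN.symm hF hG hFA
    rw [union_comm F G] at this
    rw [localConn] at h3
    omega
  -- Now `G` and `F` each have one point, not `p`. Since `insert p G` has the line, it has
  -- connectivity one to `F`, so `G ∪ F ∪ {p}` has rank `r(G) + r(F)`.
  obtain ⟨h4, h5⟩ := h.localConn_insert_eq hN hG (by omega) hGT
  have h6 := h5 F hF
  rw [M.localConn_comm, localConn_insert_left] at h6
  have h7 := hN.extension.localConn_eq hGE hFE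
  rw [localConn] at h7
  omega

/-- If `G` spans `p` and shares its point with `F` while `F` misses `p`, then adding `p` to `F`
would raise the connectivity to `G` to two, although `G` has only one point. -/
theorem isCoherent (h : M.IsStrandPair A B S T) (hN : N.IsPointExtension M S T p) :
    M.IsCoherent A B S T := by
  have key : ∀ {A B S T G F}, M.IsStrandPair A B S T → N.IsPointExtension M S T p → G ⊆ A →
      F ⊆ B → M.localConn F A = 1 → M.localConn G B = 1 → M.localConn G F = 1 →
      M.localConn G T = 1 → M.localConn F S = 1 := by
    intro A B S T G F h hN hG hF hFA hGB hGF hGT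
    by_contra hFS
    obtain ⟨h1, h2⟩ := h.symm.localConn_insert_eq hN.symm hF hFA hFS
    have h3 := h2 G hG
    rw [M.localConn_comm, hGB, localConn_insert_left, union_comm F G,
      rkNat_insert_eq_of_subset ((h.rkNat_insert_eq_iff hN hG).2 hGT) subset_union_left] at h3
    rw [← hN.extension.localConn_eq (hG.trans h.left_subset_ground)
      (hF.trans h.symm.left_subset_ground), localConn] at hGF
    omega
  refine fun G hG F hF hGB hFA ↦ ⟨fun hGF ↦ ⟨key h hN hG hF hFA hGB hGF,
    key h.symm hN.symm hF hG hGB hFA (by rwa [localConn_comm])⟩, fun hGT hFS ↦ ?_⟩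
  have h1 := h.one_le_localConn hN hG hF ((h.rkNat_insert_eq_iff hN hG).2 hGT)
    ((h.symm.rkNat_insert_eq_iff hN.symm hF).2 hFS)
  have h2 := h.localConn_le hG hF
  omega

omit [N.Finite] in
theorem isPointExtension_unique (h : M.IsStrandPair A B S T)
    (hN : N.IsPointExtension M S T p) (hN' : N'.IsPointExtension M S T p) : N = N' := by
  have _ := hN.extension.finite (finite_singleton p)
  have _ := hN'.extension.finite (finite_singleton p)
  have hp : p ∉ M.E := by simpa using hN.extension.disjoint
  have key : ∀ {N : Matroid α} [N.Finite], N.IsPointExtension M S T p → ∀ I ⊆ M.E,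
      (N.Indep (insert p I) ↔ M.Indep I ∧ ¬ M.SpansPoint A B S T (I ∩ A) (I ∩ B)) := by
    intro N _ hN I hI
    rw [← h.rkNat_insert_union_eq_iff hN inter_subset_right inter_subset_right,
      ← inter_union_distrib_left, h.union_eq, inter_eq_self_of_subset_left hI]
    have hpN : p ∈ N.E := by simp [hN.extension.ground_eq]
    have hpI : p ∉ I := fun h ↦ hp (hI h)
    by_cases hMI : M.Indep I
    · rw [and_iff_right hMI, ((hN.extension.indep_iff hI).2 hMI).insert_indep_iff_of_notMem hpI,
        ← N.mem_closure_iff_rkNat hpN, mem_sdiff, and_iff_right hpN]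
    · exact iff_of_false (fun hi ↦ hMI <| (hN.extension.indep_iff hI).1 <|
        hi.subset (subset_insert p I)) (fun hi ↦ hMI hi.1)
  refine ext_indep (by rw [hN.extension.ground_eq, hN'.extension.ground_eq]) fun I hI ↦ ?_
  rw [hN.extension.ground_eq, union_singleton] at hI
  by_cases hpI : p ∈ I
  · have hI' : I \ {p} ⊆ M.E := by simpa [sdiff_subset_iff] using hI
    have hIp : insert p (I \ {p}) = I := by simp [hpI]
    rw [← hIp, key hN _ hI', key hN' _ hI']
  · rw [subset_insert_iff_of_notMem hpI] at hI
    rw [hN.extension.indep_iff hI, hN'.extension.indep_iff hI]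

/-- From the side of `B`, a subset of `A ∪ {p}` looks like a subset of `A`. -/
theorem exists_replacement (h : M.IsStrandPair A B S T) (hN : N.IsPointExtension M S T p)
    (hX : X ⊆ insert p A) : ∃ H ⊆ A, ∀ F ⊆ B,
      (N.rkNat (X ∪ F) : ℤ) - N.rkNat X = M.rkNat (H ∪ F) - M.rkNat H := by
  by_cases hpX : p ∈ X
  swap
  · rw [subset_insert_iff_of_notMem hpX] at hX
    have hXE := hX.trans h.left_subset_ground
    refine ⟨X, hX, fun F hF ↦ ?_⟩
    rw [hN.extension.rkNat_eq hXE,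
      hN.extension.rkNat_eq (union_subset hXE (hF.trans h.symm.left_subset_ground))]
  obtain ⟨G, hG, rfl⟩ : ∃ G ⊆ A, X = insert p G :=
    ⟨X \ {p}, by simpa [sdiff_subset_iff] using hX, by simp [hpX]⟩
  have hGE := hG.trans h.left_subset_ground
  have hE : ∀ F ⊆ B, F ⊆ M.E := fun F hF ↦ hF.trans h.symm.left_subset_ground
  simp only [insert_union]
  -- The replacement is `G` if it spans `p`, `S` if `G` has no point on the guts, and `A` if it has
  -- a point other than `p`.
  by_cases hGT : M.localConn G T = 1
  · refine ⟨G, hG, fun F hF ↦ ?_⟩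
    have h1 := (h.rkNat_insert_eq_iff hN hG).2 hGT
    rw [rkNat_insert_eq_of_subset h1 subset_union_left, h1, hN.extension.rkNat_eq hGE,
      hN.extension.rkNat_eq (union_subset hGE (hE F hF))]
  have bG := h.localConn_bounds hG
  have b2 := mt (h.localConn_right_eq_of_eq_two hG) hGT
  by_cases hGB : M.localConn G B = 0
  · refine ⟨S, h.subset_left, fun F hF ↦ ?_⟩
    have h1 := h.rkNat_insert_union_of_skew hN hG hF hGB
    have h2 := h.rkNat_insert_union_of_skew hN hG (empty_subset B) hGB
    have h3 := h.symm.rkNat_insert_eq_iff hN.symm hF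
    have h4 := h.symm.localConn_bounds hF
    have h5 := N.rkNat_insert_le p F
    have h6 := N.rkNat_le_insert p F
    rw [union_empty, insert_empty_eq,
      hN.rkNat_singleton (h.notMem hN h.subset_left) h.left_nonempty] at h2
    rw [hN.extension.rkNat_eq (hE F hF)] at h3 h5 h6
    simp only [localConn, union_comm F S] at h3 h4
    omega
  · refine ⟨A, Subset.rfl, fun F hF ↦ ?_⟩
    obtain ⟨_, h1⟩ := h.localConn_insert_eq hN hG (by omega) hGT
    have h2 := h1 F hF
    rw [localConn_insert_left, hN.extension.rkNat_eq (hE F hF), localConn] at h2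
    omega

end IsStrandPair
end Matroid

/-! ### Non-crossing separations and the induction over points -/

namespace Matroid

variable {α : Type*} {M N : Matroid α} {A B C D S T S' T' : Set α} {p q : α}

namespace IsStrandPair

/-- Adding a point on the guts of `(C, D)` to the side `A ⊇ C` of another separation. -/
lemma insert_of_subset [M.Finite] [N.Finite] (h : M.IsStrandPair A B S T)
    (h' : M.IsStrandPair C D S' T') (hN : N.IsPointExtension M S' T' p) (hCA : C ⊆ A) :
    N.IsStrandPair (insert p A) B S T := by
  have hE := hN.extension
  have hAE := h.left_subset_ground
  have hBE := h.symm.left_subset_ground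
  have hA : ∀ F ⊆ B, N.localConn (insert p A) F = M.localConn A F := by
    intro F hF
    rw [localConn_insert_left, h'.rkNat_insert_left hN (h'.subset_left.trans hCA),
      h'.rkNat_insert_left hN ((h'.subset_left.trans hCA).trans subset_union_left),
      ← hE.localConn_eq hAE (hF.trans hBE), localConn]
  have hpB : p ∉ B := fun hp ↦ hE.disjoint.notMem_of_mem_left (hBE hp) (mem_singleton p)
  refine ⟨disjoint_insert_left.2 ⟨hpB, h.disjoint⟩, ?_, ?_, ⟨⟨?_, ?_⟩, ?_⟩, ⟨⟨?_, ?_⟩, ?_⟩, ?_⟩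
  · rw [insert_union, h.union_eq, hE.ground_eq, union_singleton]
  · rw [hA B Subset.rfl, h.conn_eq]
  · exact h.subset_left.trans (subset_insert p A)
  · rw [hE.localConn_eq (h.subset_left.trans hAE) hBE, h.conn_left]
  · rintro X ⟨_, hX⟩ hXS
    have hXA := hXS.trans h.subset_left
    rw [hE.localConn_eq (hXA.trans hAE) hBE] at hX
    exact h.left.le_of_le ⟨hXA, hX⟩ hXS
  · exact h.subset_right
  · rw [localConn_comm, hA T h.subset_right, localConn_comm, h.symm.conn_left]
  · rintro X ⟨hXB, hX⟩ hXT
    rw [localConn_comm, hA X hXB, localConn_comm] at hX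
    exact h.right.le_of_le ⟨hXB, hX⟩ hXT
  · rw [hE.localConn_eq (h.subset_left.trans hAE) (h.subset_right.trans hBE), h.conn_strands]

/-- The part of `G` in `insert p C` is traded for a subset `H` of `C` with the same marginal ranks
over `D`. As `D` contains `B` and the rest of `G`, connectivities to subsets of `B` are unchanged
and coherence in `M` applies. -/
lemma isCoherent_insert_of_subset [M.Finite] [N.Finite] (h : M.IsStrandPair A B S T)
    (hc : M.IsCoherent A B S T) (h' : M.IsStrandPair C D S' T')
    (hN : N.IsPointExtension M S' T' p) (hCA : C ⊆ A) : N.IsCoherent (insert p A) B S T := by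
  have hE := hN.extension
  have hAE := h.left_subset_ground
  have hBE := h.symm.left_subset_ground
  have hC : ∀ X ⊆ M.E, Disjoint X C → X ⊆ D := by
    intro X hX hd
    rw [← h'.union_eq] at hX
    exact hd.subset_right_of_subset_union hX
  have hBD : B ⊆ D := hC B hBE (h.disjoint.symm.mono_right hCA)
  intro G hG F hF
  obtain ⟨H, hH, hHF⟩ := h'.exists_replacement hN (inter_subset_right (s := G) (t := insert p C))
  have hR : G \ insert p C ⊆ A := by
    rintro x ⟨hx, hx'⟩
    obtain rfl | hx := hG hx
    · exact absurd (mem_insert x C) hx'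
    · exact hx
  have hRD : G \ insert p C ⊆ D :=
    hC _ (hR.trans hAE) (disjoint_sdiff_left.mono_right (subset_insert p C))
  have hK : H ∪ G \ insert p C ⊆ A := union_subset (hH.trans hCA) hR
  have hconn : ∀ F ⊆ B, N.localConn G F = M.localConn (H ∪ G \ insert p C) F := by
    intro F hF
    have h1 := hHF _ hRD
    have h2 := hHF _ (union_subset hRD (hF.trans hBD))
    rw [← union_assoc, ← union_assoc] at h2
    rw [inter_union_sdiff] at h1 h2
    rw [localConn, localConn, hE.rkNat_eq (hF.trans hBE)]
    omega
  have hFA : N.localConn F (insert p A) = M.localConn F A := by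
    rw [localConn, localConn, union_insert, h'.rkNat_insert_left hN (h'.subset_left.trans hCA),
      h'.rkNat_insert_left hN ((h'.subset_left.trans hCA).trans subset_union_right),
      hE.rkNat_eq hAE, hE.rkNat_eq (hF.trans hBE), hE.rkNat_eq (union_subset (hF.trans hBE) hAE)]
  rw [hconn B Subset.rfl, hconn F hF, hconn T h.subset_right, hFA,
    hE.localConn_eq (hF.trans hBE) (h.subset_left.trans hAE)]
  exact hc _ hK F hF

/-- The extension by the point of one strand pair leaves the point of another, non-crossing,
strand pair available. -/
theorem insert_and_exists_isPointExtension [M.Finite] (h : M.IsStrandPair A B S T)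
    (hq : ∃ K : Matroid α, K.IsPointExtension M S T q) (h' : M.IsStrandPair C D S' T')
    (hN : N.IsPointExtension M S' T' p) (hCA : C ⊆ A ∨ D ⊆ A) (hqp : q ≠ p) :
    N.IsStrandPair (insert p A) B S T ∧ ∃ K : Matroid α, K.IsPointExtension N S T q := by
  have _ := hN.extension.finite (finite_singleton p)
  wlog hCA' : C ⊆ A generalizing C D S' T'
  · exact this h'.symm hN.symm hCA.symm (hCA.resolve_left hCA')
  obtain ⟨K, hK⟩ := hq
  have _ := hK.extension.finite (finite_singleton q)
  have h1 := h.insert_of_subset h' hN hCA'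
  refine ⟨h1, h1.exists_isPointExtension
    (h.isCoherent_insert_of_subset (h.isCoherent hK) h' hN hCA') ?_⟩
  have hqM : q ∉ M.E := by simpa using hK.extension.disjoint
  simp [hN.extension.ground_eq, hqM, hqp]

end IsStrandPair

/-- The multi-element version. The ground set is labelled by `π : α → V`, the separations are
induced by the bipartitions `(U i, (U i)ᶜ)` of `V`, and the new element `p i` is labelled so that,
for all `j`, the side of `j` not containing it lies inside a side of `i`. -/
theorem existsUnique_extension {ι V : Type*} {π : α → V} {U : ι → Set V} {S T : ι → Set α}
    {p : ι → α} (s : Finset ι) (hp : Function.Injective p)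
    (hU : ∀ i j, (π (p i) ∈ U j ∧ ((U j)ᶜ ⊆ U i ∨ (U j)ᶜ ⊆ (U i)ᶜ)) ∨
      (π (p i) ∉ U j ∧ (U j ⊆ U i ∨ U j ⊆ (U i)ᶜ)))
    (M : Matroid α) [M.Finite]
    (hM : ∀ i ∈ s, M.IsStrandPair (M.E ∩ π ⁻¹' U i) (M.E ∩ (π ⁻¹' U i)ᶜ) (S i) (T i))
    (hext : ∀ i ∈ s, ∃ N : Matroid α, N.IsPointExtension M (S i) (T i) (p i)) :
    ∃! M' : Matroid α, M'.IsExtensionBy M (p '' s) ∧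
      ∀ i ∈ s, M'.IsCircuit (insert (p i) (S i)) ∧ M'.IsCircuit (insert (p i) (T i)) := by
  classical
  induction s using Finset.induction_on generalizing M with
  | empty =>
    refine ⟨M, ⟨⟨by simp, by simp, by simp⟩, by simp⟩, ?_⟩
    rintro M' ⟨hM', _⟩
    have := hM'.delete_eq
    simpa using this
  | @insert i s his ih =>
    obtain ⟨N, hN⟩ := hext i (Finset.mem_insert_self i s)
    have hi := hM i (Finset.mem_insert_self i s)
    have hNE : N.E = insert (p i) M.E := by rw [hN.extension.ground_eq, union_singleton]
    have _ := hN.extension.finite (finite_singleton _)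
    have hstep : ∀ j ∈ s, N.IsStrandPair (N.E ∩ π ⁻¹' U j) (N.E ∩ (π ⁻¹' U j)ᶜ) (S j) (T j) ∧
        ∃ K : Matroid α, K.IsPointExtension N (S j) (T j) (p j) := by
      intro j hj
      have hjM := hM j (Finset.mem_insert_of_mem hj)
      have hjK := hext j (Finset.mem_insert_of_mem hj)
      have hne : p j ≠ p i := fun h ↦ his (hp h ▸ hj)
      rw [hNE]
      obtain ⟨hU1, hU2⟩ | ⟨hU1, hU2⟩ := hU i j
      · rw [insert_inter_of_mem (by exact hU1), insert_inter_of_notMem (by simpa using hU1)]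
        refine hjM.insert_and_exists_isPointExtension hjK hi hN ?_ hne
        -- Complementing turns "the far side of `j` lies in a side of `i`" into "the other side of
        -- `i` lies in the near side of `j`".
        refine hU2.symm.imp (fun h x hx ↦ ⟨hx.1, ?_⟩) (fun h x hx ↦ ⟨hx.1, ?_⟩)
        · by_contra hx'
          exact h hx' hx.2
        · by_contra hx'
          exact hx.2 (h hx')
      · rw [insert_inter_of_notMem (by exact hU1), insert_inter_of_mem (by simpa using hU1)]
        have := hjM.symm.insert_and_exists_isPointExtension (hjK.imp fun _ h ↦ h.symm) hi hN (by
          refine hU2.symm.imp (fun h x hx ↦ ⟨hx.1, fun hx' ↦ ?_⟩) (fun h x hx ↦ ⟨hx.1, fun hx' ↦ ?_⟩)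
          · exact h hx' hx.2
          · exact hx.2 (h hx')) hne
        exact ⟨this.1.symm, this.2.imp fun _ h ↦ h.symm⟩
    have himage : p '' ((insert i s : Finset ι) : Set ι) = insert (p i) (p '' s) := by
      rw [Finset.coe_insert, image_insert_eq]
    have hpis : p i ∉ p '' s := by
      rintro ⟨j, hj, hji⟩
      exact his (hp hji ▸ hj)
    have hpi : p i ∉ M.E := by simpa using hN.extension.disjoint
    obtain ⟨M', ⟨hM', hM'C⟩, huniq⟩ := ih N (fun j hj ↦ (hstep j hj).1) (fun j hj ↦ (hstep j hj).2)
    refine ⟨M', ⟨⟨?_, ?_, ?_⟩, ?_⟩, ?_⟩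
    · rw [himage, disjoint_insert_right]
      exact ⟨hpi, hM'.disjoint.mono_left hN.extension.ground_subset⟩
    · rw [hM'.ground_eq, hNE, himage, insert_union, union_insert]
    · rw [himage, ← union_singleton, ← delete_delete, hM'.delete_eq, hN.extension.delete_eq]
    · intro j hj
      obtain rfl | hj := Finset.mem_insert.1 hj
      · exact ⟨(hM'.isCircuit_iff hN.left.subset_ground).2 hN.left,
          (hM'.isCircuit_iff hN.right.subset_ground).2 hN.right⟩
      · exact hM'C j hj
    · rintro K ⟨hK, hKC⟩
      rw [himage] at hK
      refine huniq K ⟨?_, fun j hj ↦ hKC j (Finset.mem_insert_of_mem hj)⟩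
      have hdisj : Disjoint M.E (p '' s) := hK.disjoint.mono_right (subset_insert _ _)
      have hdisj' : Disjoint N.E (p '' s) := by
        rw [hNE, disjoint_insert_left]
        exact ⟨hpis, hdisj⟩
      have hC : ∀ X ⊆ M.E, K.IsCircuit (insert (p i) X) →
          (K.delete (p '' s)).IsCircuit (insert (p i) X) := fun X hX hc ↦
        delete_isCircuit_iff.2 ⟨hc, disjoint_insert_left.2 ⟨hpis, hdisj.mono_left hX⟩⟩
      -- Deleting the other new elements from `K` leaves a one-point extension, which is `N` by
      -- uniqueness; so `K` extends `N`.
      have hKN : (K.delete (p '' s)).IsPointExtension M (S i) (T i) (p i) := by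
        refine ⟨⟨by simpa using hpi, ?_, ?_⟩,
          hC _ (hi.subset_left.trans hi.left_subset_ground) (hKC i (Finset.mem_insert_self i s)).1,
          hC _ (hi.subset_right.trans hi.symm.left_subset_ground)
            (hKC i (Finset.mem_insert_self i s)).2⟩
        · rw [delete_ground, hK.ground_eq, ← hNE.symm.trans hN.extension.ground_eq, ← hNE,
            union_insert, ← insert_union, ← hNE, union_sdiff_right, hdisj'.sdiff_eq_left]
        · rw [delete_delete, union_singleton, hK.delete_eq]
      refine ⟨hdisj', ?_, hi.isPointExtension_unique hKN hN⟩
      rw [hK.ground_eq, hNE, insert_union, union_insert]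

end Matroid

/-! ### Application to the tree -/

/-- A walk from `y` avoiding `f` never visits `u`, so it cannot use the edge `e`, which ends at `u`.
-/
lemma SimpleGraph.reachable_deleteEdges_of_not_reachable {V : Type*} {T : SimpleGraph V}
    {e f : Sym2 V} {u y w : V} (hu : u ∈ e) (hyu : ¬ (T.deleteEdges {f}).Reachable y u)
    (h : (T.deleteEdges {f}).Reachable y w) : (T.deleteEdges {e}).Reachable y w := by
  rw [reachable_iff_reflTransGen] at h
  induction h with
  | refl => rfl
  | @tail b c hyb hbc ih =>
    rw [← reachable_iff_reflTransGen] at hyb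
    refine ih.trans (Adj.reachable ?_)
    rw [deleteEdges_adj] at hbc ⊢
    refine ⟨hbc.1, ?_⟩
    rintro rfl
    obtain rfl | rfl := Sym2.mem_iff.1 hu
    · exact hyu hyb
    · exact hyu (hyb.trans (Adj.reachable (deleteEdges_adj.2 hbc)))

open Matroid in
theorem theorem4p1 {V α : Type*} [Finite V] (T : SimpleGraph V) (hT : T.IsTree)
    (X : V → Set α) (hXne : ∀ v, (X v).Nonempty)
    (hXdisj : Pairwise fun v w => Disjoint (X v) (X w))
    (M : Matroid α) [M.Finite] (hME : M.E = ⋃ v, X v)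
    (Y Z : T.edgeSet → Set α)
    (hYZ : ∀ e : T.edgeSet, T.InducesPartition X (e : Sym2 V) (Y e) (Z e))
    (hsep : ∀ e : T.edgeSet, M.IsExactThreeSeparation (Y e) (Z e))
    (m : T.edgeSet → ℕ)
    (Ys Zs : (e : T.edgeSet) → Fin (m e) → Set α)
    (hYs : ∀ e k, M.IsStrand (Y e) (Z e) (Ys e k))
    (hZs : ∀ e k, M.IsStrand (Z e) (Y e) (Zs e k))
    (hconn : ∀ e k, M.localConn (Ys e k) (Zs e k) = 1)
    (p : (e : T.edgeSet) → Fin (m e) → α)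
    (hp : Function.Injective fun i : (e : T.edgeSet) × Fin (m e) => p i.1 i.2)
    (hext : ∀ e k, ∃ N : Matroid α, N.IsExtensionBy M {p e k} ∧
      N.IsCircuit (Ys e k ∪ {p e k}) ∧ N.IsCircuit (Zs e k ∪ {p e k})) :
    ∃! M' : Matroid α,
      M'.IsExtensionBy M (⋃ e, Set.range (p e)) ∧
      ∀ e k, M'.IsCircuit (Ys e k ∪ {p e k}) ∧ M'.IsCircuit (Zs e k ∪ {p e k}) := by
  classical
  let ι := (e : T.edgeSet) × Fin (m e)
  choose u v huv hY hZ using hYZ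
  let R : T.edgeSet → Set V := fun e ↦ {w | (T.deleteEdges {(e : Sym2 V)}).Reachable (u e) w}
  have hpE : ∀ i : ι, p i.1 i.2 ∉ M.E := fun i ↦ by
    obtain ⟨N, hN, _⟩ := hext i.1 i.2
    simpa using hN.disjoint
  -- Old elements are sent to the vertex whose label holds them, new ones to a chosen end `u e` of
  -- their edge; other values are irrelevant.
  obtain ⟨π, hπX, hπp⟩ : ∃ π : α → V, (∀ w, ∀ x ∈ X w, π x = w) ∧
      ∀ i : ι, π (p i.1 i.2) = u i.1 := by
    have _ := hT.connected.nonempty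
    refine ⟨fun x ↦ if h : ∃ w, x ∈ X w then h.choose else
      if h : ∃ i : ι, p i.1 i.2 = x then u h.choose.1 else Classical.arbitrary V, ?_, ?_⟩
    · intro w x hx
      have h : ∃ w, x ∈ X w := ⟨w, hx⟩
      simp only [dif_pos h]
      by_contra hne
      exact (hXdisj hne).notMem_of_mem_left h.choose_spec hx
    · intro i
      have h : ¬ ∃ w, p i.1 i.2 ∈ X w := fun h ↦ hpE i (by rwa [hME, mem_iUnion])
      have h' : ∃ j : ι, p j.1 j.2 = p i.1 i.2 := ⟨i, rfl⟩
      simp only [dif_neg h, dif_pos h']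
      rw [hp h'.choose_spec]
  have hYR : ∀ e, Y e = M.E ∩ π ⁻¹' R e := by
    intro e
    ext x
    simp only [hY, SimpleGraph.labelSide, hME, mem_iUnion, mem_inter_iff, mem_preimage, R,
      mem_ofPred_eq, exists_prop]
    refine ⟨fun ⟨w, hw, hx⟩ ↦ ⟨⟨w, hx⟩, by rwa [hπX w x hx]⟩, fun ⟨⟨w, hx⟩, hw⟩ ↦ ⟨w, ?_, hx⟩⟩
    rwa [hπX w x hx] at hw
  have hZR : ∀ e, Z e = M.E ∩ (π ⁻¹' R e)ᶜ := by
    intro e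
    have h1 := (hsep e).union_eq
    have h2 := (hsep e).disjoint
    rw [← h2.sdiff_eq_right, ← union_sdiff_left, h1, hYR, sdiff_self_inter, sdiff_eq]
  -- That the two components are complementary is read off the partition of `M.E`, through an
  -- element of each non-empty label.
  have hRv : ∀ e : T.edgeSet, ∀ w ∉ R e, (T.deleteEdges {(e : Sym2 V)}).Reachable (v e) w := by
    intro e w hw
    obtain ⟨x, hx⟩ := hXne w
    have hxZ : x ∈ Z e := by
      rw [hZR]
      exact ⟨hME ▸ mem_iUnion_of_mem w hx, fun h ↦ hw (hπX w x hx ▸ h)⟩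
    simp only [hZ, SimpleGraph.labelSide, mem_iUnion, mem_ofPred_eq, exists_prop] at hxZ
    obtain ⟨w', hw', hx'⟩ := hxZ
    rwa [← hπX w x hx, hπX w' x hx']
  have hvR : ∀ e : T.edgeSet, ∀ w, (T.deleteEdges {(e : Sym2 V)}).Reachable (v e) w → w ∉ R e := by
    intro e w hw hwR
    obtain ⟨x, hx⟩ := hXne w
    refine (hsep e).disjoint.notMem_of_mem_left (a := x) ?_ ?_
    · rw [hY]
      exact mem_biUnion hwR hx
    · rw [hZ]
      exact mem_biUnion hw hx
  have hside : ∀ (e : T.edgeSet) y (Q : Set V),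
      (∀ w ∈ Q, (T.deleteEdges {(e : Sym2 V)}).Reachable y w) → Q ⊆ R e ∨ Q ⊆ (R e)ᶜ := by
    intro e y Q hQ
    by_cases hy : y ∈ R e
    · exact .inl fun w hw ↦ SimpleGraph.Reachable.trans hy (hQ w hw)
    · exact .inr fun w hw ↦ hvR e w ((hRv e y hy).trans (hQ w hw))
  have hue : ∀ e : T.edgeSet, u e ∈ (e : Sym2 V) := fun e ↦ by
    rw [huv e]
    exact Sym2.mem_mk_left _ _
  have _ : Fintype ι := Fintype.ofFinite ι
  have main := existsUnique_extension (π := π) (U := fun i : ι ↦ R i.1)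
    (S := fun i ↦ Ys i.1 i.2) (T := fun i ↦ Zs i.1 i.2) (p := fun i ↦ p i.1 i.2) Finset.univ hp
    (by
      intro i j
      rw [hπp i]
      -- The component for `j` that misses `u i.1` stays connected when the edge of `i` is deleted,
      -- so it lies on one side of `i`.
      by_cases hij : u i.1 ∈ R j.1
      · refine .inl ⟨hij, hside i.1 (v j.1) _ fun w hw ↦ ?_⟩
        exact SimpleGraph.reachable_deleteEdges_of_not_reachable (hue i.1)
          (fun h ↦ hvR _ _ h hij) (hRv _ w hw)
      · refine .inr ⟨hij, hside i.1 (u j.1) _ fun w hw ↦ ?_⟩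
        exact SimpleGraph.reachable_deleteEdges_of_not_reachable (hue i.1) hij hw) M
    (by
      intro i _
      rw [← hYR, ← hZR]
      have hs := hsep i.1
      refine ⟨hs.disjoint, hs.union_eq, ?_, hYs i.1 i.2, hZs i.1 i.2, hconn i.1 i.2⟩
      rw [localConn, hs.union_eq, hs.conn_eq])
    (by
      intro i _
      obtain ⟨N, hN, h1, h2⟩ := hext i.1 i.2
      rw [union_singleton] at h1 h2
      exact ⟨N, hN, h1, h2⟩)
  have hrange : (fun i : ι ↦ p i.1 i.2) '' ((Finset.univ : Finset ι) : Set ι) =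
      ⋃ e, range (p e) := by
    ext x
    simp [ι]
  simp only [hrange, Finset.mem_univ, true_implies, ι, Sigma.forall] at main
  simpa only [union_singleton] using main
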